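/- Let $\Omega\subset\mathbb C^2$ be a bounded domain with $\mathcal C^1$-smooth boundary which is strictly geometrically convex, i.e. for any two distinct points $x,y\in\overline\Omega$ the open segment between $x$ and $y$ is contained in $\Omega$. Let $\sigma:\mathbb C\to[0,\infty)$ be a $\mathcal C^1$-smooth function with $\sigma(0)=0$, put $$D:=\{(w,z)\in\mathbb C^2:\ \operatorname{Re}w+\sigma(z)<0\},$$ and let $\psi:\Omega\to D$ be a biholomorphism. Then there exists a point $a_\infty\in\partial\Omega$ such that for every $(w,z)\in D$ $$\lim_{t\to+\infty}\psi^{-1}(w+it,z)=a_\infty\quad\text{and}\quad\lim_{t\to+\infty}\psi^{-1}(w-it,z)=a_\infty .$$ In particular, with $L^t(w,z)=(w+it,z)$, the maps $h^t:=\psi^{-1}\circ L^t\circ\psi$ $(t\in\mathbb R)$ form a continuous one-parameter group of holomorphic automorphisms of $\Omega$ which is parabolic with parabolic boundary point $a_\infty$, i.e. $\lim_{t\to\pm\infty}h^t(p)=a_\infty$ for every $p\in\Omega$. -/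

import Mathlib

open Set Filter Topology

/-! The space `ℂ²` is `ℂ × ℂ`. All notions used below (openness, boundedness, `C¹` regularity,
holomorphy, convexity, limits) do not depend on the choice of a norm on this space. -/

/-- `Ω` has `C¹` boundary: near each boundary point, `Ω` is the sublevel set `{ρ < 0}` of a
real `C¹` function `ρ` whose differential does not vanish. -/
def HasC1Boundary (Ω : Set (ℂ × ℂ)) : Prop :=
  ∀ p ∈ frontier Ω, ∃ (U : Set (ℂ × ℂ)) (ρ : ℂ × ℂ → ℝ),
    IsOpen U ∧ p ∈ U ∧ ContDiffOn ℝ 1 ρ U ∧ (∀ x ∈ U, fderiv ℝ ρ x ≠ 0) ∧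
      Ω ∩ U = {x ∈ U | ρ x < 0}

/-- Strict geometric convexity: the open segment between any two distinct points of the closure
lies in `Ω`. (So `Ω` is convex and its boundary contains no non-degenerate segment.) -/
def IsStrictlyGeometricallyConvex (Ω : Set (ℂ × ℂ)) : Prop :=
  ∀ x ∈ closure Ω, ∀ y ∈ closure Ω, x ≠ y → openSegment ℝ x y ⊆ Ω

/-- The set `{(w, z) : Re w + σ(z) < 0}`. -/
def modelDomain (σ : ℂ → ℝ) : Set (ℂ × ℂ) :=
  {p | p.1.re + σ p.2 < 0}

/-- `ψ` is a biholomorphism of `Ω` onto `D`, with inverse `ψ.symm`. -/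
structure IsBiholomorphism (ψ : PartialEquiv (ℂ × ℂ) (ℂ × ℂ)) (Ω D : Set (ℂ × ℂ)) : Prop where
  source_eq : ψ.source = Ω
  target_eq : ψ.target = D
  holo : DifferentiableOn ℂ ψ Ω
  holo_symm : DifferentiableOn ℂ ψ.symm D

/-- `h` is a (continuous) one-parameter group of holomorphic automorphisms of `Ω`; the inverse of
`h t` on `Ω` is `h (-t)`. -/
structure IsOneParameterAutGroup (Ω : Set (ℂ × ℂ)) (h : ℝ → ℂ × ℂ → ℂ × ℂ) : Prop where
  mapsTo : ∀ t, MapsTo (h t) Ω Ω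
  holo : ∀ t, DifferentiableOn ℂ (h t) Ω
  zero : ∀ p ∈ Ω, h 0 p = p
  add : ∀ s t, ∀ p ∈ Ω, h (s + t) p = h s (h t p)
  cont : ContinuousOn (fun q : ℝ × (ℂ × ℂ) => h q.1 q.2) (univ ×ˢ Ω)

/-- The one-parameter group `h` of automorphisms of `Ω` is parabolic with boundary point `a`:
all its orbits tend to `a ∈ ∂Ω` both as `t → +∞` and as `t → -∞`. -/
structure IsParabolicWithPoint (Ω : Set (ℂ × ℂ)) (h : ℝ → ℂ × ℂ → ℂ × ℂ) (a : ℂ × ℂ) :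
    Prop where
  group : IsOneParameterAutGroup Ω h
  mem_frontier : a ∈ frontier Ω
  tendsto_atTop : ∀ p ∈ Ω, Tendsto (fun t : ℝ => h t p) atTop (𝓝 a)
  tendsto_atBot : ∀ p ∈ Ω, Tendsto (fun t : ℝ => h t p) atBot (𝓝 a)

/-- The translation `L^t (w, z) = (w + it, z)`. -/
def imTranslation (t : ℝ) (p : ℂ × ℂ) : ℂ × ℂ :=
  (p.1 + t * Complex.I, p.2)

/-- The conjugated translation `h^t = ψ⁻¹ ∘ L^t ∘ ψ`. -/
def conjTranslation (ψ : PartialEquiv (ℂ × ℂ) (ℂ × ℂ)) (t : ℝ) (p : ℂ × ℂ) : ℂ × ℂ :=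
  ψ.symm (imTranslation t (ψ p))

/-! Since `σ 0 = 0` and `σ ≥ 0`, the half-plane disc `f w = ψ.symm (w, 0)` has the holomorphic left
inverse `W = (ψ ·).1`. Two facts about convex domains then identify the limits.

If a family of discs has centres tending to a boundary point, strict convexity makes all their
points tend to it (`tendsto_disc_of_tendsto_center`). Hence a limit `y` of `f` along a vertical
line, taken along an ultrafilter, is the same for every vertical line.

By the Schwarz lemma, midpoints of points of `f {Re ≤ -M}` satisfy `Re W ≤ -M`
(`re_leftInverse_midpoint_le`). Let `x` be a limit of `f (-R)` as `R → ∞`. If `x ≠ y`, their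
midpoint lies in `Ω`, yet there `Re W ≤ -M` for every `M`, which is absurd. So every vertical limit
is `x`, in both directions; discs in `modelDomain σ` carry this from `z = 0` to all points. -/

theorem IsStrictlyGeometricallyConvex.convex {Ω : Set (ℂ × ℂ)}
    (h : IsStrictlyGeometricallyConvex Ω) : Convex ℝ Ω := by
  rw [convex_iff_openSegment_subset]
  intro x hx y hy
  rcases eq_or_ne x y with rfl | hxy
  · simpa using hx
  · exact h x (subset_closure hx) y (subset_closure hy) hxy

/-! ### Holomorphic discs near a boundary point. -/

/-- Harnack-type bound for holomorphic maps of the unit disc into the left half plane. -/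
theorem norm_le_of_mapsTo_re_nonpos {F : ℂ → ℂ} (hF : DifferentiableOn ℂ F (Metric.ball 0 1))
    (hm : MapsTo F (Metric.ball 0 1) {z | z.re ≤ 0}) {s : ℂ} (hs : s ∈ Metric.ball (0 : ℂ) 1) :
    ‖F s‖ ≤ ‖F 0‖ * (1 + ‖s‖) / (1 - ‖s‖) := by
  -- Borel–Carathéodory needs a positive bound `M` on the real part; let `M → 0`.
  have hlim : Tendsto (fun M : ℝ => 2 * M * ‖s‖ / (1 - ‖s‖) + ‖F 0‖ * (1 + ‖s‖) / (1 - ‖s‖))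
      (𝓝[>] 0) (𝓝 (2 * 0 * ‖s‖ / (1 - ‖s‖) + ‖F 0‖ * (1 + ‖s‖) / (1 - ‖s‖))) := by
    refine Tendsto.mono_left (Continuous.tendsto ?_ 0) nhdsWithin_le_nhds
    fun_prop
  have := ge_of_tendsto (b := ‖F s‖) hlim (by
    filter_upwards [self_mem_nhdsWithin] with M hM
    exact Complex.borelCaratheodory hM hF (fun z hz => le_trans (show (F z).re ≤ 0 from hm hz) (le_of_lt hM)) one_pos hs)
  simpa using this

/-- If the centres of holomorphic discs in a bounded strictly convex domain tend to a boundary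
point, then so do all their other points. -/
theorem tendsto_disc_of_tendsto_center {Ω : Set (ℂ × ℂ)} (hΩ_open : IsOpen Ω)
    (hΩ_bdd : Bornology.IsBounded Ω) (hΩ_conv : IsStrictlyGeometricallyConvex Ω)
    {ι : Type*} {l : Filter ι} {g : ι → ℂ → ℂ × ℂ}
    (hg : ∀ i, DifferentiableOn ℂ (g i) (Metric.ball 0 1))
    (hm : ∀ i, MapsTo (g i) (Metric.ball 0 1) Ω) {y : ℂ × ℂ} (hy : y ∈ frontier Ω)
    (h0 : Tendsto (fun i => g i 0) l (𝓝 y)) {s : ℂ} (hs : s ∈ Metric.ball (0 : ℂ) 1) :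
    Tendsto (fun i => g i s) l (𝓝 y) := by
  have hyΩ : y ∉ Ω := by
    rw [hΩ_open.frontier_eq] at hy
    exact hy.2
  obtain ⟨f, hf⟩ := RCLike.geometric_hahn_banach_open_point (𝕜 := ℂ) hΩ_conv.convex hΩ_open hyΩ
  have hf : ∀ a ∈ Ω, (f a).re < (f y).re := hf
  rw [tendsto_iff_ultrafilter]
  intro U hU
  obtain ⟨y', hy', hlim⟩ := (hΩ_bdd.isCompact_closure).ultrafilter_le_nhds (U.map fun i => g i s)
    (le_principal_iff.2 (Eventually.of_forall fun i => subset_closure (hm i hs) :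
      ∀ᶠ i in (U : Filter ι), g i s ∈ closure Ω))
  have hlim : Tendsto (fun i => g i s) U (𝓝 y') := hlim
  suffices y' = y from this ▸ hlim
  by_contra hne
  have hbound : ∀ i, ‖f (g i s) - f y‖ ≤ ‖f (g i 0) - f y‖ * (1 + ‖s‖) / (1 - ‖s‖) := fun i =>
    norm_le_of_mapsTo_re_nonpos (F := fun z => f (g i z) - f y)
      ((f.differentiable.comp_differentiableOn (hg i)).sub_const _)
      (fun z hz => by simpa using (hf _ (hm i hz)).le) hs
  have h1 : Tendsto (fun i => ‖f (g i 0) - f y‖ * (1 + ‖s‖) / (1 - ‖s‖)) U (𝓝 0) := by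
    have : Tendsto (fun i => f (g i 0)) U (𝓝 (f y)) :=
      (f.continuous.tendsto y).comp (h0.mono_left hU)
    simpa using (((this.sub_const (f y)).norm.mul_const (1 + ‖s‖)).div_const (1 - ‖s‖))
  have h2 : Tendsto (fun i => ‖f (g i s) - f y‖) U (𝓝 ‖f y' - f y‖) :=
    (((f.continuous.tendsto y').comp hlim).sub_const _).norm
  -- Any cluster point `y'` lies on the supporting hyperplane at `y`; if `y' ≠ y`, so does the
  -- midpoint, although it is in `Ω`.
  have h3 : f y' = f y := by
    have := le_of_tendsto_of_tendsto' h2 h1 hbound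
    exact sub_eq_zero.1 (norm_le_zero_iff.1 this)
  have hmem : midpoint ℝ y' y ∈ Ω :=
    hΩ_conv y' hy' y (frontier_subset_closure hy) hne (midpoint_mem_openSegment y' y)
  have h4 := hf _ hmem
  rw [midpoint_eq_smul_add, f.map_smul_of_tower, map_add, h3, Complex.smul_re] at h4
  simp at h4
  linarith

/-! ### Half planes as limits of hyperbolic balls. -/

/-- The Cayley map sends `-1/u` to `0`. Divided by `4 * u`, its defect from the unit circle tends to
`-w.re` as `u → 0`, so balls centred at `-1/u` become half planes. -/
theorem normSq_div_sub_one {u : ℝ} (hu : 0 < u) {w : ℂ} (hw : w.re < 0) :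
    ‖((u : ℂ) * w + 1) / (u * w - 1)‖ ^ 2 = 1 - 4 * u * (-w.re / ‖(u : ℂ) * w - 1‖ ^ 2) := by
  have hne : ‖(u : ℂ) * w - 1‖ ^ 2 ≠ 0 := by
    have : (u : ℂ) * w - 1 ≠ 0 := fun h => by
      have := congrArg Complex.re h
      simp at this
      nlinarith
    simpa using this
  rw [norm_div, div_pow, eq_sub_iff_add_eq, mul_div_assoc', ← add_div, div_eq_one_iff_eq hne,
    Complex.sq_norm, Complex.sq_norm, Complex.normSq_apply, Complex.normSq_apply]
  simp
  ring

/-- Let `f` be a holomorphic map of the left half plane into a convex set `Ω` which has a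
holomorphic left inverse `W`. Then the preimages under `W` of the half planes `{Re ≤ -M}` contain
the midpoints of the points of `f {Re ≤ -M}`. -/
theorem re_leftInverse_midpoint_le {Ω : Set (ℂ × ℂ)} (hconv : Convex ℝ Ω) {f : ℂ → ℂ × ℂ}
    {W : ℂ × ℂ → ℂ} (hf : DifferentiableOn ℂ f {w | w.re < 0}) (hfm : MapsTo f {w | w.re < 0} Ω)
    (hW : DifferentiableOn ℂ W Ω) (hWm : MapsTo W Ω {w | w.re < 0})
    (hWf : ∀ w : ℂ, w.re < 0 → W (f w) = w) {α β : ℂ} (hα : α.re < 0) (hβ : β.re < 0) :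
    (W (midpoint ℝ (f α) (f β))).re ≤ max α.re β.re := by
  have hsub : ∀ {u : ℝ}, 0 < u → ∀ {w : ℂ}, w.re < 0 → (u : ℂ) * w - 1 ≠ 0 := by
    intro u hu w hw h
    have := congrArg Complex.re h
    simp at this
    nlinarith
  have hmid : ∀ {a b : ℂ × ℂ}, a ∈ Ω → b ∈ Ω → midpoint ℝ a b ∈ Ω := fun ha hb =>
    hconv.segment_subset ha hb (midpoint_mem_segment _ _)
  set q := midpoint ℝ (f α) (f β) with hq
  have hqW : (W q).re < 0 := hWm (hmid (hfm hα) (hfm hβ))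
  have key : ∀ u : ℝ, 0 < u → min (-α.re / ‖(u : ℂ) * α - 1‖ ^ 2) (-β.re / ‖(u : ℂ) * β - 1‖ ^ 2) ≤
      -(W q).re / ‖(u : ℂ) * W q - 1‖ ^ 2 := by
    intro u hu
    have hu' : (u : ℂ) ≠ 0 := by exact_mod_cast hu.ne'
    set C : ℂ → ℂ := fun w => (u * w + 1) / (u * w - 1) with hC
    set D : ℂ → ℂ := fun ζ => (ζ + 1) / (u * (ζ - 1)) with hD
    have hCD : ∀ w : ℂ, w.re < 0 → D (C w) = w := by
      intro w hw
      have h1 := hsub hu hw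
      have h2 : C w - 1 = 2 / (u * w - 1) := by
        simp only [hC]
        field_simp
        ring
      simp only [hD]
      rw [h2]
      simp only [hC]
      field_simp
      ring
    have hC1 : ∀ w : ℂ, w.re < 0 → ‖C w‖ < 1 := by
      intro w hw
      have h1 := normSq_div_sub_one hu hw
      have h2 : 0 < ‖(u : ℂ) * w - 1‖ := norm_pos_iff.2 (hsub hu hw)
      have h3 : 0 < 4 * u * (-w.re / ‖(u : ℂ) * w - 1‖ ^ 2) := by
        have : 0 < -w.re := by linarith
        positivity
      have : ‖C w‖ ^ 2 < 1 := by
        simp only [hC]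
        linarith
      nlinarith [norm_nonneg (C w)]
    have hne1 : ∀ ζ : ℂ, ‖ζ‖ < 1 → ζ - 1 ≠ 0 := by
      intro ζ hζ h
      rw [sub_eq_zero.1 h] at hζ
      simp at hζ
    have hDre : ∀ ζ : ℂ, ‖ζ‖ < 1 → (D ζ).re < 0 := by
      intro ζ hζ
      have h1 := hne1 ζ hζ
      have h2 : 0 < Complex.normSq (ζ - 1) := Complex.normSq_pos.2 h1
      have h3 : D ζ = ((u⁻¹ : ℝ) : ℂ) * ((ζ + 1) / (ζ - 1)) := by
        simp only [hD]
        push_cast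
        field_simp
      have h4 : ((ζ + 1) / (ζ - 1)).re = (Complex.normSq ζ - 1) / Complex.normSq (ζ - 1) := by
        rw [Complex.div_re, ← add_div]
        congr 1
        simp [Complex.normSq_apply]
        ring
      rw [h3, Complex.re_ofReal_mul, h4]
      refine mul_neg_of_pos_of_neg (by positivity) (div_neg_of_neg_of_pos ?_ h2)
      rw [← Complex.sq_norm]
      nlinarith [norm_nonneg ζ]
    have hDd : DifferentiableOn ℂ D (Metric.ball 0 1) := by
      refine DifferentiableOn.div (by fun_prop) (by fun_prop) fun ζ hζ => ?_
      exact mul_ne_zero hu' (hne1 ζ (by simpa using hζ))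
    have hCd : DifferentiableOn ℂ C {w | w.re < 0} :=
      DifferentiableOn.div (by fun_prop) (by fun_prop) fun w hw => hsub hu hw
    have hD0 : (D 0).re < 0 := hDre 0 (by simp)
    have hDC0 : C (D 0) = 0 := by
      simp only [hC, hD]
      field_simp
      simp
    set r : ℝ := max ‖C α‖ ‖C β‖ with hr
    have hr1 : r < 1 := max_lt (hC1 α hα) (hC1 β hβ)
    have hCq : ‖C (W q)‖ ≤ r := by
      -- The disc below divides by `r`, so `r = 0` (where `α = β`) is treated apart.
      rcases (le_max_of_le_left (norm_nonneg (C α)) : 0 ≤ r).eq_or_lt with h0 | h0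
      · have hα0 : C α = 0 := norm_le_zero_iff.1 (h0 ▸ le_max_left _ _)
        have hβ0 : C β = 0 := norm_le_zero_iff.1 (h0 ▸ le_max_right _ _)
        have : α = β := by rw [← hCD α hα, ← hCD β hβ, hα0, hβ0]
        have hWq : W q = α := by rw [hq, ← this, midpoint_self, hWf α hα]
        rw [hWq]
        exact le_max_left _ _
      · have hmaps : ∀ c : ℂ, ‖c‖ ≤ r → ∀ ζ : ℂ, ‖ζ‖ < 1 → ‖ζ * (c / r)‖ < 1 := by
          intro c hc ζ hζ
          have : ‖c / r‖ ≤ 1 := by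
            rw [norm_div, Complex.norm_real, Real.norm_of_nonneg h0.le]
            exact div_le_one_of_le₀ hc h0.le
          rw [norm_mul]
          nlinarith [norm_nonneg ζ, norm_nonneg (c / r)]
        have hdisc : ∀ c : ℂ, ‖c‖ ≤ r →
            DifferentiableOn ℂ (fun ζ : ℂ => f (D (ζ * (c / r)))) (Metric.ball 0 1) := by
          intro c hc
          refine hf.comp (hDd.comp (by fun_prop) fun ζ hζ => ?_) fun ζ hζ => ?_
          · simpa using hmaps c hc ζ (by simpa using hζ)
          · exact hDre _ (hmaps c hc ζ (by simpa using hζ))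
        -- A disc in `Ω` through `f (D 0)` at `0` and `q` at `r`; the Schwarz lemma for `C ∘ W ∘ g`
        -- gives `‖C (W q)‖ ≤ r`.
        set g : ℂ → ℂ × ℂ := fun ζ =>
          midpoint ℝ (f (D (ζ * (C α / r)))) (f (D (ζ * (C β / r)))) with hg
        have hαr : ‖C α‖ ≤ r := le_max_left _ _
        have hβr : ‖C β‖ ≤ r := le_max_right _ _
        have hgm : MapsTo g (Metric.ball 0 1) Ω := fun ζ hζ =>
          hmid (hfm (hDre _ (hmaps _ hαr ζ (by simpa using hζ))))
            (hfm (hDre _ (hmaps _ hβr ζ (by simpa using hζ))))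
        have hgd : DifferentiableOn ℂ g (Metric.ball 0 1) := by
          simp only [hg, midpoint_eq_smul_add]
          exact ((hdisc _ hαr).add (hdisc _ hβr)).const_smul (⅟2 : ℝ)
        have hCWg : DifferentiableOn ℂ (fun ζ => C (W (g ζ))) (Metric.ball 0 1) :=
          hCd.comp (hW.comp hgd hgm) fun ζ hζ => hWm (hgm hζ)
        have hr0 : (r : ℂ) ≠ 0 := by exact_mod_cast h0.ne'
        have hgr : g r = q := by
          simp only [hg, mul_div_cancel₀ _ hr0]
          rw [hCD α hα, hCD β hβ]
        have := Complex.norm_le_norm_of_mapsTo_ball hCWg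
          (fun ζ hζ => by simpa using (hC1 _ (hWm (hgm hζ))).le)
          (by simp [hg, hWf _ hD0, hDC0]) (z := (r : ℂ))
          (by rwa [Complex.norm_real, Real.norm_of_nonneg h0.le])
        rwa [hgr, Complex.norm_real, Real.norm_of_nonneg h0.le] at this
    have hCq2 := normSq_div_sub_one hu hqW
    have aux : ∀ a : ℂ, a.re < 0 → ‖C (W q)‖ ≤ ‖C a‖ →
        -a.re / ‖(u : ℂ) * a - 1‖ ^ 2 ≤ -(W q).re / ‖(u : ℂ) * W q - 1‖ ^ 2 := by
      intro a ha hle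
      have h1 := normSq_div_sub_one hu ha
      have h2 : ‖C (W q)‖ ^ 2 ≤ ‖C a‖ ^ 2 := by gcongr
      simp only [hC] at h2
      rw [h1, hCq2] at h2
      have h3 : 0 < 4 * u := by linarith
      exact le_of_mul_le_mul_left (by linarith) h3
    rcases le_max_iff.1 hCq with h | h
    · exact (min_le_left _ _).trans (aux α hα h)
    · exact (min_le_right _ _).trans (aux β hβ h)
  have hlim : ∀ w : ℂ, Tendsto (fun u : ℝ => -w.re / ‖(u : ℂ) * w - 1‖ ^ 2) (𝓝[>] 0)
      (𝓝 (-w.re)) := by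
    intro w
    have : ContinuousAt (fun u : ℝ => -w.re / ‖(u : ℂ) * w - 1‖ ^ 2) 0 :=
      ContinuousAt.div (by fun_prop) (by fun_prop) (by simp)
    simpa using this.tendsto.mono_left nhdsWithin_le_nhds
  have := le_of_tendsto_of_tendsto ((hlim α).min (hlim β)) (hlim (W q))
    (by filter_upwards [self_mem_nhdsWithin] with u hu using key u hu)
  rw [min_neg_neg] at this
  linarith

/-! ### Boundary limits of translates. -/

/-- At a limit inside `Ω`, continuity of `ψ` would keep `p` bounded. -/
theorem mem_frontier_of_tendsto_of_cobounded {Ω D : Set (ℂ × ℂ)} (hΩ_open : IsOpen Ω)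
    {ψ : PartialEquiv (ℂ × ℂ) (ℂ × ℂ)} (hψ : IsBiholomorphism ψ Ω D) {ι : Type*} {l : Filter ι}
    [l.NeBot] {p : ι → ℂ × ℂ} (hpD : ∀ i, p i ∈ D) (hp : Tendsto p l (Bornology.cobounded (ℂ × ℂ)))
    {y : ℂ × ℂ} (hy : Tendsto (fun i => ψ.symm (p i)) l (𝓝 y)) : y ∈ frontier Ω := by
  have hmem : ∀ i, ψ.symm (p i) ∈ Ω := fun i =>
    hψ.source_eq ▸ ψ.map_target (hψ.target_eq ▸ hpD i)
  rw [hΩ_open.frontier_eq]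
  refine ⟨mem_closure_of_tendsto hy (Eventually.of_forall hmem), fun hyΩ => ?_⟩
  have h1 := ((hψ.holo.continuousOn.continuousAt (hΩ_open.mem_nhds hyΩ)).tendsto.comp hy).norm
  refine not_tendsto_nhds_of_tendsto_atTop (tendsto_norm_cobounded_atTop.comp hp) _
    (h1.congr fun i => ?_)
  simp [ψ.right_inv (hψ.target_eq ▸ hpD i)]

theorem tendsto_add_mul_I_cobounded (w z : ℂ) :
    Tendsto (fun t : ℝ => (w + t * Complex.I, z)) (Bornology.cobounded ℝ)
      (Bornology.cobounded (ℂ × ℂ)) := by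
  rw [← tendsto_norm_atTop_iff_cobounded]
  refine tendsto_atTop_mono (f := fun t : ℝ => ‖t‖ - ‖w‖) (fun t => ?_)
    (tendsto_atTop_add_const_right _ _ tendsto_norm_cobounded_atTop)
  refine le_trans ?_ (norm_fst_le (w + t * Complex.I, z))
  have := norm_sub_le (w + t * Complex.I) w
  simp at this ⊢
  linarith

theorem exists_tendsto_translates {Ω : Set (ℂ × ℂ)} (hΩ_open : IsOpen Ω)
    (hΩ_bdd : Bornology.IsBounded Ω) (hΩ_conv : IsStrictlyGeometricallyConvex Ω)
    {σ : ℂ → ℝ} (hσ : Continuous σ) (hσ_nonneg : ∀ z, 0 ≤ σ z) (hσ_zero : σ 0 = 0)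
    {ψ : PartialEquiv (ℂ × ℂ) (ℂ × ℂ)} (hψ : IsBiholomorphism ψ Ω (modelDomain σ)) :
    ∃ a ∈ frontier Ω, ∀ w z : ℂ, (w, z) ∈ modelDomain σ →
      Tendsto (fun t : ℝ => ψ.symm (w + t * Complex.I, z)) (Bornology.cobounded ℝ) (𝓝 a) := by
  have hφm : MapsTo ψ.symm (modelDomain σ) Ω := fun p hp =>
    hψ.source_eq ▸ ψ.map_target (hψ.target_eq ▸ hp)
  have hψm : MapsTo ψ Ω (modelDomain σ) := fun p hp =>
    hψ.target_eq ▸ ψ.map_source (hψ.source_eq ▸ hp)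
  have hD0 : ∀ w : ℂ, w.re < 0 → (w, (0 : ℂ)) ∈ modelDomain σ := fun w hw => by
    simpa [modelDomain, hσ_zero] using hw
  have hDt : ∀ {w z : ℂ} (t : ℝ), (w, z) ∈ modelDomain σ →
      (w + t * Complex.I, z) ∈ modelDomain σ := fun t h => by
    simpa [modelDomain] using h
  set f : ℂ → ℂ × ℂ := fun w => ψ.symm (w, 0) with hf
  have hfd : DifferentiableOn ℂ f {w | w.re < 0} :=
    hψ.holo_symm.comp (by fun_prop) fun w hw => hD0 w hw
  have hfm : MapsTo f {w | w.re < 0} Ω := fun w hw => hφm (hD0 w hw)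
  set W : ℂ × ℂ → ℂ := fun p => (ψ p).1 with hW
  have hWd : DifferentiableOn ℂ W Ω := hψ.holo.fst
  have hWm : MapsTo W Ω {w | w.re < 0} := fun p hp => by
    have h1 : (ψ p).1.re + σ (ψ p).2 < 0 := hψm hp
    have h2 := hσ_nonneg (ψ p).2
    show (ψ p).1.re < 0
    linarith
  have hWf : ∀ w : ℂ, w.re < 0 → W (f w) = w := fun w hw => by
    simp only [hW, hf]
    rw [ψ.right_inv (hψ.target_eq ▸ hD0 w hw)]
  have hcpt : ∀ {ι : Type} (U : Ultrafilter ι) (p : ι → ℂ × ℂ), (∀ᶠ i in (U : Filter ι), p i ∈ Ω) →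
      ∃ y ∈ closure Ω, Tendsto p U (𝓝 y) := fun U p hp =>
    hΩ_bdd.isCompact_closure.ultrafilter_le_nhds (U.map p)
      (le_principal_iff.2 (hp.mono fun _ h => subset_closure h))
  -- the limit along the axis of the disc `f`
  obtain ⟨x, hx, hxlim⟩ := hcpt (Ultrafilter.of atTop) (fun R : ℝ => f (-R)) (by
    filter_upwards [Ultrafilter.of_le atTop (Ioi_mem_atTop (0 : ℝ))] with R hR
    exact hfm (by simpa using hR))
  have hvert : ∀ M : ℝ, 0 < M → ∀ t : ℝ, (-M + t * Complex.I : ℂ).re < 0 := fun M hM t => by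
    simpa using hM
  have hU : ∀ U : Ultrafilter ℝ, (U : Filter ℝ) ≤ Bornology.cobounded ℝ → ∀ M : ℝ, 0 < M →
      Tendsto (fun t : ℝ => f (-M + t * Complex.I)) U (𝓝 x) := by
    intro U hUc
    have hy : ∀ M : ℝ, 0 < M → ∃ y ∈ frontier Ω,
        Tendsto (fun t : ℝ => f (-M + t * Complex.I)) U (𝓝 y) := by
      intro M hM
      obtain ⟨y, -, hy⟩ := hcpt U (fun t : ℝ => f (-M + t * Complex.I))
        (Eventually.of_forall fun t => hfm (hvert M hM t))
      exact ⟨y, mem_frontier_of_tendsto_of_cobounded hΩ_open hψ (fun t => hD0 _ (hvert M hM t))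
        ((tendsto_add_mul_I_cobounded (-M) 0).mono_left hUc) hy, hy⟩
    have hsame : ∀ N M : ℝ, 0 < M → M ≤ N → ∀ y ∈ frontier Ω,
        Tendsto (fun t : ℝ => f (-N + t * Complex.I)) U (𝓝 y) →
        Tendsto (fun t : ℝ => f (-M + t * Complex.I)) U (𝓝 y) := by
      intro N M hM hMN y hy hlim
      have hN : 0 < N := hM.trans_le hMN
      -- The largest disc centred at `-N + it`; it reaches every `-M + it` with `0 < M ≤ N`.
      have hmaps : ∀ t : ℝ, MapsTo (fun ζ : ℂ => -N + t * Complex.I + N * ζ) (Metric.ball 0 1)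
          {w | w.re < 0} := by
        intro t ζ hζ
        have h1 : ζ.re < 1 := (Complex.re_le_norm ζ).trans_lt (by simpa using hζ)
        simp
        nlinarith
      have := tendsto_disc_of_tendsto_center hΩ_open hΩ_bdd hΩ_conv
        (g := fun t ζ => f (-N + t * Complex.I + N * ζ)) (l := (U : Filter ℝ))
        (fun t => hfd.comp (by fun_prop) (hmaps t)) (fun t => hfm.comp (hmaps t)) hy
        (by simpa using hlim) (s := (((N - M) / N : ℝ) : ℂ)) (by
          rw [mem_ball_zero_iff, Complex.norm_real, Real.norm_of_nonneg
            (div_nonneg (by linarith) hN.le), div_lt_one hN]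
          linarith)
      refine this.congr fun t => ?_
      have : (N : ℂ) ≠ 0 := by exact_mod_cast hN.ne'
      congr 1
      push_cast
      field_simp
      ring
    obtain ⟨y, hyf, hy1⟩ := hy 1 one_pos
    have hyM : ∀ M : ℝ, 0 < M → Tendsto (fun t : ℝ => f (-M + t * Complex.I)) U (𝓝 y) := by
      intro M hM
      have hN : 0 < max M 1 := lt_max_of_lt_left hM
      obtain ⟨y', hyf', hy'⟩ := hy (max M 1) hN
      have := tendsto_nhds_unique (hsame _ 1 one_pos (le_max_right _ _) y' hyf' hy') hy1
      exact this ▸ hsame _ M hM (le_max_left _ _) y' hyf' hy'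
    suffices x = y from this ▸ hyM
    by_contra hne
    have hqΩ : midpoint ℝ x y ∈ Ω :=
      hΩ_conv x hx y (frontier_subset_closure hyf) hne (midpoint_mem_openSegment x y)
    have hle : ∀ M : ℝ, 0 < M → (W (midpoint ℝ x y)).re ≤ -M := by
      intro M hM
      have hlim : Tendsto (fun q : ℝ × ℝ => midpoint ℝ (f (-q.1)) (f (-M + q.2 * Complex.I)))
          (((Ultrafilter.of (atTop : Filter ℝ) : Ultrafilter ℝ) : Filter ℝ) ×ˢ (U : Filter ℝ)) (𝓝 (midpoint ℝ x y)) := by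
        simp only [midpoint_eq_smul_add]
        exact ((hxlim.comp tendsto_fst).add ((hyM M hM).comp tendsto_snd)).const_smul _
      have hlim2 := (Complex.continuous_re.tendsto _).comp
        ((hWd.continuousOn.continuousAt (hΩ_open.mem_nhds hqΩ)).tendsto.comp hlim)
      refine le_of_tendsto hlim2 ?_
      have hev : ∀ᶠ R in ((Ultrafilter.of (atTop : Filter ℝ) : Ultrafilter ℝ) : Filter ℝ), M ≤ R :=
        Ultrafilter.of_le atTop (Ici_mem_atTop M)
      filter_upwards [tendsto_fst.eventually hev] with q hq
      refine (re_leftInverse_midpoint_le hΩ_conv.convex hfd hfm hWd hWm hWf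
        (by simp; linarith) (hvert M hM q.2)).trans (max_le ?_ ?_)
      · simpa using hq
      · simp
    have h1 := hle (1 - (W (midpoint ℝ x y)).re) (by
      have : (W (midpoint ℝ x y)).re < 0 := hWm hqΩ
      linarith)
    linarith
  have hfx : ∀ M : ℝ, 0 < M →
      Tendsto (fun t : ℝ => f (-M + t * Complex.I)) (Bornology.cobounded ℝ) (𝓝 x) := fun M hM =>
    (tendsto_iff_ultrafilter _ _ _).2 fun U hUc => hU U hUc M hM
  have hxf : x ∈ frontier Ω :=
    mem_frontier_of_tendsto_of_cobounded hΩ_open hψ (fun t => hD0 _ (hvert 1 one_pos t))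
      (tendsto_add_mul_I_cobounded (-(1 : ℝ)) 0) (hfx 1 one_pos)
  refine ⟨x, hxf, fun w z hwz => ?_⟩
  -- Radius `2 * ‖z‖` puts `z` at parameter `1 / 2` of a disc in the `z`-direction, which fits in
  -- the domain once `M > S`.
  obtain ⟨S, hS⟩ := (isCompact_closedBall (0 : ℂ) (2 * ‖z‖)).bddAbove_image hσ.continuousOn
  have hS : ∀ ζ : ℂ, ‖ζ‖ ≤ 2 * ‖z‖ → σ ζ ≤ S := fun ζ hζ =>
    hS (mem_image_of_mem σ (by simpa using hζ))
  have hzS : σ z ≤ S := hS z (by linarith [norm_nonneg z])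
  have hwz' : w.re + σ z < 0 := hwz
  have hσz := hσ_nonneg z
  set M : ℝ := S + |w.re| + 1 with hM
  have hwM := neg_abs_le w.re
  have hw0 := abs_nonneg w.re
  have hM0 : 0 < M := by linarith
  have hmaps1 : ∀ t : ℝ, MapsTo (fun ζ : ℂ => ((-M + t * Complex.I : ℂ), 2 * z * ζ))
      (Metric.ball 0 1) (modelDomain σ) := by
    intro t ζ hζ
    have h1 : ‖ζ‖ < 1 := by simpa using hζ
    have h2 := hS (2 * z * ζ) (by
      simp only [norm_mul, Complex.norm_ofNat]
      nlinarith [norm_nonneg z])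
    simp [modelDomain]
    linarith
  have h1 : Tendsto (fun t : ℝ => ψ.symm (-M + t * Complex.I, z)) (Bornology.cobounded ℝ)
      (𝓝 x) := by
    have := tendsto_disc_of_tendsto_center hΩ_open hΩ_bdd hΩ_conv
      (g := fun t ζ => ψ.symm ((-M + t * Complex.I : ℂ), 2 * z * ζ)) (l := Bornology.cobounded ℝ)
      (fun t => hψ.holo_symm.comp (by fun_prop) (hmaps1 t)) (fun t => hφm.comp (hmaps1 t)) hxf
      (by simpa using hfx M hM0) (s := 1 / 2) (by simp; norm_num)
    refine this.congr fun t => ?_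
    congr 2
    ring
  have h2 : Tendsto (fun t : ℝ => ψ.symm (-M + (t + w.im : ℝ) * Complex.I, z))
      (Bornology.cobounded ℝ) (𝓝 x) :=
    h1.comp (tendsto_add_const_cobounded w.im)
  -- The distance from `-M` to the edge `Re = -σ z` of the slice at height `z`; this disc moves the
  -- real part from `-M` to `w.re`.
  set ρ : ℝ := M - σ z with hρ
  have hρ0 : 0 < ρ := by linarith
  have hmaps2 : ∀ t : ℝ, MapsTo
      (fun ζ : ℂ => ((-M + (t + w.im : ℝ) * Complex.I + ρ * ζ : ℂ), z))
      (Metric.ball 0 1) (modelDomain σ) := by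
    intro t ζ hζ
    have h3 : ζ.re < 1 := (Complex.re_le_norm ζ).trans_lt (by simpa using hζ)
    simp [modelDomain]
    nlinarith
  have h3 := tendsto_disc_of_tendsto_center hΩ_open hΩ_bdd hΩ_conv
    (g := fun t ζ => ψ.symm ((-M + (t + w.im : ℝ) * Complex.I + ρ * ζ : ℂ), z))
    (l := Bornology.cobounded ℝ)
    (fun t => hψ.holo_symm.comp (by fun_prop) (hmaps2 t)) (fun t => hφm.comp (hmaps2 t)) hxf
    (by simpa using h2) (s := (((w.re + M) / ρ : ℝ) : ℂ)) (by
      rw [mem_ball_zero_iff, Complex.norm_real, Real.norm_eq_abs, abs_lt, lt_div_iff₀ hρ0,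
        div_lt_one hρ0]
      constructor <;> linarith)
  refine h3.congr fun t => ?_
  have : (ρ : ℂ) ≠ 0 := by exact_mod_cast hρ0.ne'
  congr 2
  apply Complex.ext
  · simp [mul_div_cancel₀ _ hρ0.ne', -Complex.ofReal_div]
  · simp [-Complex.ofReal_div, add_comm]

/-! ### The parabolic one-parameter group. -/

theorem isOneParameterAutGroup_conjTranslation {Ω : Set (ℂ × ℂ)} {σ : ℂ → ℝ}
    {ψ : PartialEquiv (ℂ × ℂ) (ℂ × ℂ)} (hψ : IsBiholomorphism ψ Ω (modelDomain σ)) :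
    IsOneParameterAutGroup Ω (conjTranslation ψ) := by
  have hφm : MapsTo ψ.symm (modelDomain σ) Ω := fun p hp =>
    hψ.source_eq ▸ ψ.map_target (hψ.target_eq ▸ hp)
  have hψm : MapsTo ψ Ω (modelDomain σ) := fun p hp =>
    hψ.target_eq ▸ ψ.map_source (hψ.source_eq ▸ hp)
  have hL : ∀ t, MapsTo (imTranslation t) (modelDomain σ) (modelDomain σ) := fun t p hp => by
    simpa [modelDomain, imTranslation] using hp
  refine ⟨fun t p hp => hφm (hL t (hψm hp)), fun t => ?_, fun p hp => ?_, fun s t p hp => ?_, ?_⟩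
  · have hLd : Differentiable ℂ (imTranslation t) := by
      unfold imTranslation
      fun_prop
    exact hψ.holo_symm.comp (hLd.comp_differentiableOn hψ.holo) fun p hp => hL t (hψm hp)
  · simp [conjTranslation, imTranslation, ψ.left_inv (hψ.source_eq ▸ hp)]
  · have hmem : imTranslation t (ψ p) ∈ ψ.target := hψ.target_eq ▸ hL t (hψm hp)
    simp only [conjTranslation]
    rw [ψ.right_inv hmem]
    congr 1
    simp only [imTranslation]
    push_cast
    congr 1
    ring
  · refine hψ.holo_symm.continuousOn.comp ?_ fun q hq => hL q.1 (hψm hq.2)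
    have h1 : ContinuousOn (fun q : ℝ × (ℂ × ℂ) => ψ q.2) (univ ×ˢ Ω) :=
      hψ.holo.continuousOn.comp continuousOn_snd fun q hq => hq.2
    unfold imTranslation
    exact (h1.fst.add (by fun_prop)).prodMk h1.snd

theorem theorem1p1 (Ω : Set (ℂ × ℂ)) (hΩ_open : IsOpen Ω) (hΩ_conn : IsConnected Ω)
    (hΩ_bdd : Bornology.IsBounded Ω) (hΩ_C1 : HasC1Boundary Ω)
    (hΩ_conv : IsStrictlyGeometricallyConvex Ω)
    (σ : ℂ → ℝ) (hσ_C1 : ContDiff ℝ 1 σ) (hσ_nonneg : ∀ z, 0 ≤ σ z) (hσ_zero : σ 0 = 0)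
    (ψ : PartialEquiv (ℂ × ℂ) (ℂ × ℂ)) (hψ : IsBiholomorphism ψ Ω (modelDomain σ)) :
    ∃ a ∈ frontier Ω,
      (∀ w z : ℂ, (w, z) ∈ modelDomain σ →
        Tendsto (fun t : ℝ => ψ.symm (w + t * Complex.I, z)) atTop (𝓝 a) ∧
        Tendsto (fun t : ℝ => ψ.symm (w - t * Complex.I, z)) atTop (𝓝 a)) ∧
      IsParabolicWithPoint Ω (conjTranslation ψ) a := by
  obtain ⟨a, ha, hlim⟩ :=
    exists_tendsto_translates hΩ_open hΩ_bdd hΩ_conv hσ_C1.continuous hσ_nonneg hσ_zero hψ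
  have hψm : MapsTo ψ Ω (modelDomain σ) := fun p hp =>
    hψ.target_eq ▸ ψ.map_source (hψ.source_eq ▸ hp)
  have htop : (atTop : Filter ℝ) ≤ Bornology.cobounded ℝ := by
    rw [IsOrderBornology.cobounded_eq]
    exact le_sup_right
  have hbot : (atBot : Filter ℝ) ≤ Bornology.cobounded ℝ := by
    rw [IsOrderBornology.cobounded_eq]
    exact le_sup_left
  refine ⟨a, ha, fun w z hwz => ⟨(hlim w z hwz).mono_left htop, ?_⟩,
    ⟨isOneParameterAutGroup_conjTranslation hψ, ha,
      fun p hp => (hlim _ _ (hψm hp)).mono_left htop,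
      fun p hp => (hlim _ _ (hψm hp)).mono_left hbot⟩⟩
  refine (((hlim w z hwz).mono_left hbot).comp tendsto_neg_atTop_atBot).congr fun t => ?_
  simp [sub_eq_add_neg]
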